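/- **Setting.** Let $X\subseteq\mathbb{R}^{mn}$, $f:\mathbb{R}^{mn}\to\mathbb{R}$, $b=(b_i)_{i\in L}\in\mathbb{R}^{ln}$ with $L=\{1,\dots,l\}$ and $b_i\in\mathbb{R}^n$, and let $A$ be a real $ln\times mn$ matrix with row blocks $A_i$ ($i\in L$) of size $n\times mn$. For $I\subseteq L$ write $A_I=(A_i)_{i\in I}$, $b_I=(b_i)_{i\in I}$, $F_I=\{x\in\mathbb{R}^{mn}: A_Ix=b_I\}$ and $Y_I=\{y=(y_i)_{i\in L}\in\mathbb{R}^{ln}: y_i=0 \text{ for } i\notin I\}$. Call $I\subseteq L$ a *basic index set* if $A_Ix=b_I$ implies $Ax=b$. Let $\mathcal L(x,y)=f(x)+\langle y,Ax-b\rangle$, and let $W^*$ be the set of its saddle points on $X\times\mathbb{R}^{ln}$, i.e. of all $(x^*,y^*)\in X\times\mathbb{R}^{ln}$ with $\mathcal L(x^*,y)\le\mathcal L(x^*,y^*)\le\mathcal L(x,y^*)$ for all $y\in\mathbb{R}^{ln}$, $x\in X$. **Method (PDM).** Choose $I_0\subseteq L$ and $(x^0,y^0)\in X\times Y_{I_0}$.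 For $k=1,2,\dots$ choose $I_k\subseteq L$ and $\lambda_k>0$, and set $$p^k=\pi_{Y_{I_k}}\big[y^{k-1}+\lambda_k(Ax^{k-1}-b)\big],$$ $$x^k=\operatorname*{argmin}_{x\in X}\Big\{f(x)+\langle p^k,Ax-b\rangle+\tfrac{1}{2\lambda_k}\|x-x^{k-1}\|^2\Big\},$$ $$y^k=\pi_{Y_{I_k}}\big[y^{k-1}+\lambda_k(Ax^k-b)\big],$$ where $\pi_U$ is the orthogonal projection onto $U$ and $\|\cdot\|$ is the Euclidean norm (for matrices: the spectral norm). Put $w^k=(x^k,y^k)$. **Theorem 3.2.** Assume * (A1) $X$ is convex and closed, and the problem of minimizing $f$ over $\{x\in X: Ax=b\}$ has a solution; * (A2) $f$ is convex; * (constraint qualification) the relative interior of $X$ contains a point $x$ with $Ax=b$ or, more generally, $W^*\neq\varnothing$. Suppose that for some $\tau\in(0,1)$ $$\tau\le\lambda_k\le\frac{\sqrt{1-\tau}}{\sqrt2\,\|A_{I_k}\|}\qquad(k\ge1),$$ where the upper bound is void if $A_{I_k}=0$, and that there is a nonempty basic index set $I$ with $I\subseteq I_k$ for all $k\ge1$.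 Then: 1. the sequence $\{w^k\}$ has limit points, and each of them belongs to $W^*$; 2. if moreover $I_k=I$ for infinitely many $k$, then the whole sequence $\{w^k\}$ converges to a point of $W^*$. -/

import Mathlib

open scoped Topology Matrix.Norms.L2Operator

namespace PDM

/-- The primal space `ℝ^{mn}`: `m` blocks of dimension `n`, with the Euclidean norm. -/
abbrev Primal (m n : ℕ) : Type := EuclideanSpace ℝ (Fin m × Fin n)

/-- The dual space `ℝ^{ln}`: `l` blocks of dimension `n`, with the Euclidean norm. -/
abbrev Dual (l n : ℕ) : Type := EuclideanSpace ℝ (Fin l × Fin n)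

/-- The matrices with `l n` rows and `m n` columns, the rows grouped in `l` blocks of `n` rows. -/
abbrev BlockMatrix (l m n : ℕ) : Type := Matrix (Fin l × Fin n) (Fin m × Fin n) ℝ

variable {l m n : ℕ}

/-- `A_I`: the submatrix of `A` that consists of the row blocks `A_i`, `i ∈ I`. -/
def subMatrix (A : BlockMatrix l m n) (I : Finset (Fin l)) :
    Matrix ({i // i ∈ I} × Fin n) (Fin m × Fin n) ℝ :=
  A.submatrix (fun q => (q.1.1, q.2)) id

/-- `b_I = (b_i)_{i ∈ I}`. -/
def subVector (b : Dual l n) (I : Finset (Fin l)) : {i // i ∈ I} × Fin n → ℝ :=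
  fun q => b (q.1.1, q.2)

/-- `F_I = {x | A_I x = b_I}`. -/
def affineSet (A : BlockMatrix l m n) (b : Dual l n) (I : Finset (Fin l)) : Set (Primal m n) :=
  {x | (subMatrix A I).mulVec x.ofLp = subVector b I}

/-- `D_I = X ∩ F_I`. -/
def feasibleSet (X : Set (Primal m n)) (A : BlockMatrix l m n) (b : Dual l n)
    (I : Finset (Fin l)) : Set (Primal m n) :=
  X ∩ affineSet A b I

/-- `D*_I`: the set of minimizers of `f` over `D_I`. -/
def solutionSet (f : Primal m n → ℝ) (X : Set (Primal m n)) (A : BlockMatrix l m n)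
    (b : Dual l n) (I : Finset (Fin l)) : Set (Primal m n) :=
  {x | x ∈ feasibleSet X A b I ∧ ∀ z ∈ feasibleSet X A b I, f x ≤ f z}

/-- `I` is a basic index set with respect to `J`: `I ⊆ J` and `A_I x = b_I` implies
`A_J x = b_J`. -/
def IsBasicWrt (A : BlockMatrix l m n) (b : Dual l n) (I J : Finset (Fin l)) : Prop :=
  I ⊆ J ∧ ∀ x : Primal m n, x ∈ affineSet A b I → x ∈ affineSet A b J

/-- `I` is a basic index set: it is basic with respect to the set `L` of all indices. -/
def IsBasic (A : BlockMatrix l m n) (b : Dual l n) (I : Finset (Fin l)) : Prop :=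
  IsBasicWrt A b I Finset.univ

/-- The constraintResidual `A x - b`. -/
noncomputable def constraintResidual (A : BlockMatrix l m n) (b : Dual l n) (x : Primal m n) : Dual l n :=
  WithLp.toLp 2 (A.mulVec x.ofLp) - b

/-- The Lagrange function `f(x) + ⟨y, A x - b⟩`. -/
noncomputable def lagrangian (f : Primal m n → ℝ) (A : BlockMatrix l m n) (b : Dual l n)
    (x : Primal m n) (y : Dual l n) : ℝ :=
  f x + inner ℝ y (constraintResidual A b x)

/-- `Y_I`: the subspace of all `y` with `y_i = 0` for `i ∉ I`. -/
def dualSet (n : ℕ) (I : Finset (Fin l)) : Submodule ℝ (Dual l n) where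
  carrier := {y | ∀ i, i ∉ I → ∀ j, y (i, j) = 0}
  add_mem' := by
    intro y z hy hz i hi j
    simp [hy i hi j, hz i hi j]
  zero_mem' := by
    intro i _ j
    simp
  smul_mem' := by
    intro c y hy i hi j
    simp [hy i hi j]

/-- `W*_I`: the saddle points of the Lagrange function on `X × Y_I`. -/
def saddleSet (f : Primal m n → ℝ) (X : Set (Primal m n)) (A : BlockMatrix l m n)
    (b : Dual l n) (I : Finset (Fin l)) : Set (Primal m n × Dual l n) :=
  {w | w.1 ∈ X ∧ w.2 ∈ dualSet n I ∧
    (∀ y ∈ dualSet n I, lagrangian f A b w.1 y ≤ lagrangian f A b w.1 w.2) ∧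
    (∀ x ∈ X, lagrangian f A b w.1 w.2 ≤ lagrangian f A b x w.2)}

/-- The sequences `x k`, `y k`, `p k` are generated by the primal-dual method with the index
sets `Ik k` and the numbers `lam k > 0`. The values `lam 0` and `p 0` are not used. -/
structure IsPDM (f : Primal m n → ℝ) (X : Set (Primal m n)) (A : BlockMatrix l m n)
    (b : Dual l n) (Ik : ℕ → Finset (Fin l)) (lam : ℕ → ℝ) (x : ℕ → Primal m n)
    (y p : ℕ → Dual l n) : Prop where
  x_zero_mem : x 0 ∈ X
  y_zero_mem : y 0 ∈ dualSet n (Ik 0)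
  lam_pos : ∀ k, 0 < lam (k + 1)
  /-- `p^k` is the orthogonal projection of `y^{k-1} + λ_k (A x^{k-1} - b)` onto `Y_{I_k}`. -/
  p_step : ∀ k, p (k + 1) =
    (dualSet n (Ik (k + 1))).starProjection (y k + lam (k + 1) • constraintResidual A b (x k))
  x_mem : ∀ k, x (k + 1) ∈ X
  /-- `x^k` minimizes `f(z) + ⟨p^k, A z - b⟩ + 0.5 λ_k⁻¹ ‖z - x^{k-1}‖²` over `z ∈ X`. -/
  x_step : ∀ k, ∀ z ∈ X,
    f (x (k + 1)) + inner ℝ (p (k + 1)) (constraintResidual A b (x (k + 1)))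
        + (1 / 2) * (lam (k + 1))⁻¹ * ‖x (k + 1) - x k‖ ^ 2
      ≤ f z + inner ℝ (p (k + 1)) (constraintResidual A b z)
        + (1 / 2) * (lam (k + 1))⁻¹ * ‖z - x k‖ ^ 2
  /-- `y^k` is the orthogonal projection of `y^{k-1} + λ_k (A x^k - b)` onto `Y_{I_k}`. -/
  y_step : ∀ k, y (k + 1) =
    (dualSet n (Ik (k + 1))).starProjection (y k + lam (k + 1) • constraintResidual A b (x (k + 1)))

/-- The step-size rule `τ ≤ λ_k ≤ √(1 - τ) / (√2 ‖A_{I_k}‖)` for all `k ≥ 1`, with the spectral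
norm. The upper bound is multiplied out, so that it is void when `A_{I_k} = 0`. -/
def StepRule (A : BlockMatrix l m n) (Ik : ℕ → Finset (Fin l)) (lam : ℕ → ℝ) (τ : ℝ) : Prop :=
  ∀ k, 1 ≤ k → τ ≤ lam k ∧ lam k * (√2 * ‖subMatrix A (Ik k)‖) ≤ √(1 - τ)

/-- `w` is a limit point of the sequence `u`: the limit of some subsequence. -/
def IsLimitPoint {E : Type*} [TopologicalSpace E] (u : ℕ → E) (w : E) : Prop :=
  ∃ φ : ℕ → ℕ, StrictMono φ ∧ Filter.Tendsto (u ∘ φ) Filter.atTop (𝓝 w)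

end PDM

/-! The method is Fejér monotone: if `(x*, y*)` is a saddle point and `y*` lies in `Y_{I_k}`, then
`‖x^k - x*‖² + ‖y^k - y*‖²` is smaller than its predecessor by at least `τ‖x^k - x^{k-1}‖² + ½‖y^k -
y^{k-1}‖²` (`IsPDM.fejer`). Since `I_k` varies, one saddle point must serve all steps. This is what
the basic set `I` provides: over a consistent system it forces `ker A_I ⊆ ker A`, so any multiplier
can be replaced by one in `Y_I ⊆ Y_{I_k}` (`exists_saddle_mem_dualSet`). A saddle point to start
from comes from the constraint qualification, through a cone extension argument
(`exists_multiplier`).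

Hence the iterates are bounded and successive differences vanish. Vanishing dual differences force
`A_I x = b_I` at limit points, hence `Ax = b`; the variational inequality of the proximal step
passes to the limit because `y^k - p^k → 0`.

If `I_k = I` infinitely often, some limit point has its multiplier in the closed subspace `Y_I`. The
Fejér distance to that limit point is then monotone and tends to zero along a subsequence, hence
along the whole sequence. -/

namespace PDM

/-! ### Lagrange multipliers for affine constraints -/

section Duality

variable {E F : Type*} [NormedAddCommGroup E] [NormedSpace ℝ E]
  [NormedAddCommGroup F] [InnerProductSpace ℝ F] [FiniteDimensional ℝ F]

/-- Every linear functional on a finite-dimensional inner product space is an inner product. -/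
lemma exists_inner_eq (g : F →ₗ[ℝ] ℝ) : ∃ y : F, ∀ v, inner ℝ y v = g v := by
  have : CompleteSpace F := FiniteDimensional.complete ℝ F
  refine ⟨(InnerProductSpace.toDual ℝ F).symm (LinearMap.toContinuousLinearMap g), fun v => ?_⟩
  simp

/-- A point of the relative interior can be moved a little in every direction of the affine span. -/
lemma exists_add_smul_mem_of_mem_intrinsicInterior {X : Set E} {x₀ : E}
    (h : x₀ ∈ intrinsicInterior ℝ X) {w : E} (hw : w ∈ vectorSpan ℝ X) :
    ∃ ε : ℝ, 0 < ε ∧ x₀ + ε • w ∈ X := by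
  obtain ⟨z, hz, rfl⟩ := mem_intrinsicInterior.1 h
  have hw' : w ∈ (affineSpan ℝ X).direction := by rwa [direction_affineSpan]
  have hmem : ∀ t : ℝ, (z : E) + t • w ∈ affineSpan ℝ X := fun t => by
    rw [add_comm]
    exact AffineSubspace.vadd_mem_of_mem_direction (Submodule.smul_mem _ t hw') z.2
  let γ : ℝ → affineSpan ℝ X := fun t => ⟨(z : E) + t • w, hmem t⟩
  have hγ : Continuous γ := by
    refine Continuous.subtype_mk ?_ _
    fun_prop
  have h0 : γ 0 = z := Subtype.ext (by simp [γ])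
  have hnhds : ∀ᶠ t in 𝓝 (0 : ℝ), γ t ∈ interior (Subtype.val ⁻¹' X) := by
    refine hγ.continuousAt.eventually ?_
    rw [h0]
    exact isOpen_interior.mem_nhds hz
  have hright : ∀ᶠ t in 𝓝[>] (0 : ℝ), γ t ∈ interior (Subtype.val ⁻¹' X) :=
    hnhds.filter_mono nhdsWithin_le_nhds
  obtain ⟨ε, hε, hpos⟩ := (hright.and self_mem_nhdsWithin).exists
  have hε' : γ ε ∈ Subtype.val ⁻¹' X := interior_subset hε
  exact ⟨ε, hpos, hε'⟩

/-- The cone generated by the epigraph of the constrained problem that minimizes `f - α` over the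
points `x` of `X` with `T x = T x₀`. -/
def valueCone {X : Set E} (hX : Convex ℝ X) {f : E → ℝ} (hf : ConvexOn ℝ X f) (T : E →ₗ[ℝ] F)
    {x₀ : E} (hx₀ : x₀ ∈ X) (α : ℝ) (V : Submodule ℝ F) : PointedCone ℝ (V × ℝ) where
  carrier := {q | ∃ c : ℝ, 0 ≤ c ∧ ∃ x ∈ X, (q.1 : F) = c • T (x - x₀) ∧ c * (f x - α) ≤ q.2}
  zero_mem' := ⟨0, le_rfl, x₀, hx₀, by simp, by simp⟩
  add_mem' := by
    rintro ⟨u, s⟩ ⟨v, t⟩ ⟨c, hc, x, hx, hu, hs⟩ ⟨d, hd, z, hz, hv, ht⟩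
    dsimp only at hu hv hs ht
    rcases eq_or_lt_of_le (add_nonneg hc hd) with h | h
    · obtain rfl : c = 0 := by linarith
      obtain rfl : d = 0 := by linarith
      refine ⟨0, le_rfl, x₀, hx₀, ?_, ?_⟩
      · simp [hu, hv]
      · simp only [Prod.mk_add_mk]
        linarith
    · have hne : c + d ≠ 0 := h.ne'
      have hsum : c / (c + d) + d / (c + d) = 1 := by field_simp
      have hc' : 0 ≤ c / (c + d) := by positivity
      have hd' : 0 ≤ d / (c + d) := by positivity
      refine ⟨c + d, h.le, (c / (c + d)) • x + (d / (c + d)) • z, hX hx hz hc' hd' hsum, ?_, ?_⟩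
      · simp only [Prod.mk_add_mk, Submodule.coe_add, hu, hv, map_sub, map_add, map_smul,
          smul_sub, smul_add, smul_smul, mul_div_cancel₀ _ hne, add_smul]
        abel
      · have hconv := hf.2 hx hz hc' hd' hsum
        simp only [smul_eq_mul] at hconv
        have hmul := mul_le_mul_of_nonneg_left hconv h.le
        have hexp : (c + d) * (c / (c + d) * f x + d / (c + d) * f z) = c * f x + d * f z := by
          field_simp
        simp only [Prod.mk_add_mk]
        nlinarith
  smul_mem' := by
    rintro a ⟨u, s⟩ ⟨c, hc, x, hx, hu, hs⟩
    refine ⟨a * c, mul_nonneg a.2 hc, x, hx, ?_, ?_⟩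
    · have : ((a • u : V) : F) = (a : ℝ) • (u : F) := rfl
      simp only [Prod.smul_mk, this]
      dsimp only at hu
      rw [hu, smul_smul]
    · have : a • s = (a : ℝ) * s := rfl
      simp only [Prod.smul_mk, this]
      dsimp only at hs
      nlinarith [mul_le_mul_of_nonneg_left hs a.2]

/-- Lagrange multipliers exist for affine constraints when a feasible point is relatively
interior. -/
lemma exists_multiplier {X : Set E} (hX : Convex ℝ X) {f : E → ℝ} (hf : ConvexOn ℝ X f)
    (T : E →ₗ[ℝ] F) {x₀ : E} (hx₀ : x₀ ∈ X)
    (hint : ∀ w ∈ vectorSpan ℝ X, ∃ ε : ℝ, 0 < ε ∧ x₀ + ε • w ∈ X)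
    {α : ℝ} (hα : ∀ x ∈ X, T x = T x₀ → α ≤ f x) :
    ∃ y : F, ∀ x ∈ X, α ≤ f x + inner ℝ y (T (x - x₀)) := by
  -- Restricting to the image of the directions of `X` makes the cofinality condition of
  -- `riesz_extension` available: `x₀` can be moved only in these directions.
  let V : Submodule ℝ F := (vectorSpan ℝ X).map T
  let K := valueCone hX hf T hx₀ α V
  let D : Submodule ℝ (V × ℝ) := LinearMap.range (LinearMap.inr ℝ V ℝ)
  have hD : ∀ q ∈ D, q.1 = 0 := by
    rintro _ ⟨t, rfl⟩
    rfl
  let φ : (V × ℝ) →ₗ.[ℝ] ℝ := ⟨D, (LinearMap.snd ℝ V ℝ).comp D.subtype⟩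
  obtain ⟨g, hg, hgK⟩ := riesz_extension K φ
    (by
      rintro ⟨q, hq⟩ ⟨c, hc, x, hx, h1, h2⟩
      change 0 ≤ q.2
      change (q.1 : F) = _ at h1
      change c * (f x - α) ≤ q.2 at h2
      rw [hD q hq] at h1
      rcases eq_or_lt_of_le hc with rfl | hc
      · simpa using h2
      · have hT : T (x - x₀) = 0 := by
          rcases smul_eq_zero.1 h1.symm with h | h
          · exact absurd h hc.ne'
          · exact h
        have := hα x hx (by rwa [map_sub, sub_eq_zero] at hT)
        nlinarith [mul_nonneg hc.le (sub_nonneg.2 this)])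
    (by
      rintro ⟨⟨_, w, hw, rfl⟩, t⟩
      obtain ⟨ε, hε, hmem⟩ := hint w hw
      -- Scaling the point `x₀ + ε • w` by `ε⁻¹` realizes exactly `T w`; the vertical shift raises
      -- `t` to the matching cost.
      refine ⟨⟨(0, ε⁻¹ * (f (x₀ + ε • w) - α) - t), ⟨_, rfl⟩⟩, ε⁻¹, by positivity, _, hmem, ?_, ?_⟩
      · simp [smul_smul, hε.ne']
      · simp)
  obtain ⟨h, hh⟩ := LinearMap.exists_extend (g ∘ₗ LinearMap.inl ℝ V ℝ)
  obtain ⟨y, hy⟩ := exists_inner_eq h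
  refine ⟨y, fun x hx => ?_⟩
  have hv : T (x - x₀) ∈ V := ⟨_, vsub_mem_vectorSpan ℝ hx hx₀, rfl⟩
  have h1 : h (T (x - x₀)) = g (⟨T (x - x₀), hv⟩, 0) := LinearMap.congr_fun hh ⟨T (x - x₀), hv⟩
  have h2 : g (0, f x - α) = f x - α := hg ⟨(0, f x - α), ⟨_, rfl⟩⟩
  have h3 : 0 ≤ g (⟨T (x - x₀), hv⟩, f x - α) := hgK _ ⟨1, zero_le_one, x, hx, by simp, by simp⟩
  have h4 : ((⟨T (x - x₀), hv⟩, f x - α) : V × ℝ) = (⟨T (x - x₀), hv⟩, 0) + (0, f x - α) := by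
    simp
  rw [h4, map_add, h2, ← h1, ← hy] at h3
  linarith

/-- A functional `⟨y, T ·⟩` is represented by an element of the subspace `U` if it vanishes
wherever the projection of `T` onto `U` does. -/
lemma exists_mem_inner_eq (T : E →ₗ[ℝ] F) (U : Submodule ℝ F) (y : F)
    (hker : ∀ d, U.starProjection (T d) = 0 → T d = 0) :
    ∃ u ∈ U, ∀ d, inner ℝ u (T d) = inner ℝ y (T d) := by
  let S : E →ₗ[ℝ] F := U.starProjection.toLinearMap ∘ₗ T
  let φ : E →ₗ[ℝ] ℝ := (innerₛₗ ℝ y) ∘ₗ T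
  -- The range of the transpose of `S` is the annihilator of `ker S`.
  have hφ : φ ∈ LinearMap.range S.dualMap := by
    rw [LinearMap.range_dualMap_eq_dualAnnihilator_ker, Submodule.mem_dualAnnihilator]
    intro d hd
    have : T d = 0 := hker d hd
    simp [φ, this]
  obtain ⟨g, hg⟩ := hφ
  obtain ⟨z, hz⟩ := exists_inner_eq g
  refine ⟨U.starProjection z, U.starProjection_apply_mem z, fun d => ?_⟩
  rw [Submodule.inner_starProjection_left_eq_right, hz]
  exact LinearMap.congr_fun hg d

end Duality

/-! ### Optimality of a proximal step -/

section Prox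

variable {E : Type*} [NormedAddCommGroup E] [InnerProductSpace ℝ E]

/-- The variational inequality of a proximal step. -/
lemma prox_variational {X : Set E} {g : E → ℝ} (hg : ConvexOn ℝ X g) {c : ℝ}
    {u v : E} (hu : u ∈ X)
    (hmin : ∀ z ∈ X, g u + (1 / 2) * c * ‖u - v‖ ^ 2 ≤ g z + (1 / 2) * c * ‖z - v‖ ^ 2)
    {z : E} (hz : z ∈ X) : g u ≤ g z + c * inner ℝ (u - v) (z - u) := by
  -- Comparing `u` with `(1 - t)u + tz` and dividing by `t` leaves a quadratic remainder of order
  -- `t`, which vanishes as `t → 0`.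
  have key : ∀ t ∈ Set.Ioc (0 : ℝ) 1,
      g u ≤ g z + c * inner ℝ (u - v) (z - u) + t * ((1 / 2) * c * ‖z - u‖ ^ 2) := by
    rintro t ⟨ht0, ht1⟩
    have hconv := hg.2 hu hz (sub_nonneg.2 ht1) ht0.le (by ring)
    have h := hmin _ (hg.1 hu hz (sub_nonneg.2 ht1) ht0.le (by ring))
    have hv : (1 - t) • u + t • z - v = (u - v) + t • (z - u) := by module
    rw [hv, norm_add_sq_real, inner_smul_right, norm_smul, mul_pow, Real.norm_eq_abs,
      sq_abs] at h
    simp only [smul_eq_mul] at hconv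
    have : t * g u ≤ t * (g z + c * inner ℝ (u - v) (z - u)
        + t * ((1 / 2) * c * ‖z - u‖ ^ 2)) := by nlinarith
    exact le_of_mul_le_mul_left this ht0
  have hlim : Filter.Tendsto
      (fun t : ℝ => g z + c * inner ℝ (u - v) (z - u) + t * ((1 / 2) * c * ‖z - u‖ ^ 2))
      (𝓝[>] 0) (𝓝 (g z + c * inner ℝ (u - v) (z - u))) := by
    have : Continuous fun t : ℝ =>
        g z + c * inner ℝ (u - v) (z - u) + t * ((1 / 2) * c * ‖z - u‖ ^ 2) := by fun_prop
    simpa using this.continuousWithinAt (s := Set.Ioi 0) (x := 0) |>.tendsto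
  exact ge_of_tendsto hlim (Filter.eventually_of_mem (Ioc_mem_nhdsGT zero_lt_one) key)

end Prox

end PDM

namespace PDM

/-! ### Residuals and projections onto blocks -/

section Constraint

variable {l m n : ℕ} {A : BlockMatrix l m n} {b : Dual l n}

lemma constraintResidual_sub (x z : Primal m n) :
    constraintResidual A b x - constraintResidual A b z = Matrix.toLpLin 2 2 A (x - z) := by
  rw [map_sub]
  exact sub_sub_sub_cancel_right _ _ _

lemma continuous_constraintResidual : Continuous (constraintResidual A b) := by
  have h : Continuous (Matrix.toLpLin 2 2 A : Primal m n →ₗ[ℝ] Dual l n) :=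
    LinearMap.continuous_of_finiteDimensional _
  exact h.sub continuous_const

lemma mem_affineSet_iff {x : Primal m n} {J : Finset (Fin l)} :
    x ∈ affineSet A b J ↔ ∀ i ∈ J, ∀ j, constraintResidual A b x (i, j) = 0 := by
  have h : ∀ i j, constraintResidual A b x (i, j) = A.mulVec x.ofLp (i, j) - b (i, j) :=
    fun _ _ => rfl
  simp only [h, sub_eq_zero]
  constructor
  · intro hx i hi j
    exact congrFun hx (⟨i, hi⟩, j)
  · intro hx
    funext ⟨⟨i, hi⟩, j⟩
    exact hx i hi j

lemma mem_affineSet_univ_iff {x : Primal m n} :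
    x ∈ affineSet A b Finset.univ ↔ constraintResidual A b x = 0 := by
  rw [mem_affineSet_iff]
  constructor
  · intro h
    ext ⟨i, j⟩
    exact h i (Finset.mem_univ i) j
  · intro h i _ j
    rw [h]
    rfl

lemma mem_dualSet_univ (y : Dual l n) : y ∈ dualSet n (Finset.univ : Finset (Fin l)) :=
  fun i hi => absurd (Finset.mem_univ i) hi

lemma dualSet_mono {I J : Finset (Fin l)} (h : I ⊆ J) : dualSet n I ≤ dualSet n J :=
  fun _ hy i hi => hy i fun hI => hi (h hI)

lemma starProjection_dualSet_apply (J : Finset (Fin l)) (v : Dual l n) (q : Fin l × Fin n) :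
    (dualSet n J).starProjection v q = if q.1 ∈ J then v q else 0 := by
  have h : (dualSet n J).starProjection v =
      WithLp.toLp 2 (fun q : Fin l × Fin n => if q.1 ∈ J then v q else 0) := by
    refine Submodule.eq_starProjection_of_mem_of_inner_eq_zero ?_ ?_
    · intro i hi j
      simp [hi]
    · intro w hw
      rw [PiLp.inner_apply]
      refine Finset.sum_eq_zero ?_
      rintro ⟨i, j⟩ -
      by_cases hi : i ∈ J
      · simp [hi]
      · simp [hw i hi j]
  rw [h]

lemma starProjection_constraintResidual_eq_zero_iff {x : Primal m n} {J : Finset (Fin l)} :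
    (dualSet n J).starProjection (constraintResidual A b x) = 0 ↔ x ∈ affineSet A b J := by
  rw [mem_affineSet_iff]
  constructor
  · intro h i hi j
    have := starProjection_dualSet_apply J (constraintResidual A b x) (i, j)
    rw [h] at this
    simpa [hi] using this.symm
  · intro h
    ext ⟨i, j⟩
    rw [starProjection_dualSet_apply]
    by_cases hi : i ∈ J
    · simp [hi, h i hi j]
    · simp [hi]

/-- The projected vector is `A_J d` padded with zeros, so the norm in the step rule controls it. -/
lemma norm_starProjection_toLpLin_le (J : Finset (Fin l)) (d : Primal m n) :
    ‖(dualSet n J).starProjection (Matrix.toLpLin 2 2 A d)‖ ≤ ‖subMatrix A J‖ * ‖d‖ := by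
  refine le_trans (le_of_eq ?_) (Matrix.l2_opNorm_mulVec (subMatrix A J) d)
  rw [EuclideanSpace.norm_eq, EuclideanSpace.norm_eq]
  congr 1
  simp only [starProjection_dualSet_apply]
  rw [Fintype.sum_prod_type, Fintype.sum_prod_type]
  rw [← Finset.sum_subset (Finset.subset_univ J), ← Finset.sum_attach]
  · refine Finset.sum_congr rfl fun i _ => Finset.sum_congr rfl fun j _ => ?_
    rw [if_pos i.2]
    rfl
  · intro i _ hi
    simp [hi]

/-- Translation by a feasible point turns the inclusion of affine sets into `ker A_I ⊆ ker A`. -/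
lemma IsBasic.toLpLin_eq_zero {I : Finset (Fin l)} (hI : IsBasic A b I) {x : Primal m n}
    (hx : constraintResidual A b x = 0) {d : Primal m n}
    (hd : (dualSet n I).starProjection (Matrix.toLpLin 2 2 A d) = 0) :
    Matrix.toLpLin 2 2 A d = 0 := by
  have h : constraintResidual A b (x + d) = Matrix.toLpLin 2 2 A d := by
    have := constraintResidual_sub (A := A) (b := b) (x + d) x
    rwa [hx, sub_zero, add_sub_cancel_left] at this
  rw [← h, starProjection_constraintResidual_eq_zero_iff] at hd
  rw [← h]
  exact mem_affineSet_univ_iff.1 (hI.2 _ hd)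

end Constraint

/-! ### Existence and choice of saddle points -/

section Saddle

variable {l m n : ℕ} {f : Primal m n → ℝ} {X : Set (Primal m n)} {A : BlockMatrix l m n}
  {b : Dual l n}

/-- The saddle points on `X × ℝ^{ln}` are the pairs of a feasible point and a multiplier for it. -/
lemma mem_saddleSet_univ_iff {w : Primal m n × Dual l n} :
    w ∈ saddleSet f X A b Finset.univ ↔ w.1 ∈ X ∧ constraintResidual A b w.1 = 0 ∧
      ∀ z ∈ X, f w.1 ≤ f z + inner ℝ w.2 (constraintResidual A b z) := by
  obtain ⟨x, y⟩ := w
  constructor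
  · rintro ⟨hx, -, hy, hz⟩
    have h0 : constraintResidual A b x = 0 := by
      -- Moving the multiplier by the residual itself gives `‖Ax - b‖² ≤ 0`.
      have := hy (y + constraintResidual A b x) (mem_dualSet_univ _)
      simp only [lagrangian, inner_add_left] at this
      exact real_inner_self_nonpos.1 (by linarith)
    refine ⟨hx, h0, fun z hzX => ?_⟩
    have := hz z hzX
    simpa only [lagrangian, h0, inner_zero_right, add_zero] using this
  · rintro ⟨hx, h0, hz⟩
    dsimp only at hx h0 hz
    refine ⟨hx, mem_dualSet_univ _, fun y' _ => ?_, fun z hzX => ?_⟩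
    · simp [lagrangian, h0]
    · simpa only [lagrangian, h0, inner_zero_right, add_zero] using hz z hzX

/-- The multiplier is built at the relatively interior point but serves the minimizer too, as both
have residual zero. -/
lemma saddleSet_nonempty_of_intrinsicInterior (hX : Convex ℝ X) (hf : ConvexOn ℝ Set.univ f)
    (hsol : (solutionSet f X A b Finset.univ).Nonempty)
    (hint : (intrinsicInterior ℝ X ∩ affineSet A b Finset.univ).Nonempty) :
    (saddleSet f X A b Finset.univ).Nonempty := by
  obtain ⟨xs, hxs, hmin⟩ := hsol
  obtain ⟨x₀, hx₀, hAx₀⟩ := hint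
  rw [mem_affineSet_univ_iff] at hAx₀
  have hres : ∀ z, Matrix.toLpLin 2 2 A (z - x₀) = constraintResidual A b z := fun z => by
    rw [← constraintResidual_sub (b := b), hAx₀, sub_zero]
  obtain ⟨y, hy⟩ := exists_multiplier hX (hf.subset (Set.subset_univ _) hX)
    (Matrix.toLpLin 2 2 A : Primal m n →ₗ[ℝ] Dual l n) (intrinsicInterior_subset hx₀)
    (fun w hw => exists_add_smul_mem_of_mem_intrinsicInterior hx₀ hw) (α := f xs)
    (fun x hx hT => hmin x ⟨hx, mem_affineSet_univ_iff.2 (by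
      rw [← hres, map_sub, hT, sub_self])⟩)
  refine ⟨(xs, y), mem_saddleSet_univ_iff.2 ⟨hxs.1, mem_affineSet_univ_iff.1 hxs.2, ?_⟩⟩
  intro z hz
  have := hy z hz
  rwa [hres] at this

/-- For a basic index set `I`, the multiplier of a saddle point may be taken from `Y_I`. -/
lemma exists_saddle_mem_dualSet {I : Finset (Fin l)} (hI : IsBasic A b I)
    (h : (saddleSet f X A b Finset.univ).Nonempty) :
    ∃ w ∈ saddleSet f X A b Finset.univ, w.2 ∈ dualSet n I := by
  obtain ⟨⟨xs, ys⟩, hw⟩ := h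
  obtain ⟨hx, h0, hz⟩ := mem_saddleSet_univ_iff.1 hw
  dsimp only at hx h0 hz
  obtain ⟨u, hu, hinner⟩ := exists_mem_inner_eq
    (Matrix.toLpLin 2 2 A : Primal m n →ₗ[ℝ] Dual l n) (dualSet n I) ys
    (fun d hd => hI.toLpLin_eq_zero h0 hd)
  refine ⟨(xs, u), mem_saddleSet_univ_iff.2 ⟨hx, h0, fun z hzX => ?_⟩, hu⟩
  have h1 := hz z hzX
  have h2 := hinner (z - xs)
  rw [← constraintResidual_sub (b := b), h0, sub_zero] at h2
  dsimp only
  rwa [h2]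

end Saddle

end PDM

namespace PDM

/-! ### The projected dual step -/

section DualStep

variable {F : Type*} [NormedAddCommGroup F] [InnerProductSpace ℝ F]

/-- The vector `c • r - (y₁ - y₀)` is orthogonal to `U`, which contains `y₁ - u`. The point `y₀`
need not lie in `U`, so the index set may change between steps. -/
lemma norm_sub_sq_of_starProjection {U : Submodule ℝ F} [U.HasOrthogonalProjection] {c : ℝ}
    {y₀ y₁ r u : F} (hy : y₁ = U.starProjection (y₀ + c • r)) (hu : u ∈ U) :
    ‖y₁ - u‖ ^ 2 = ‖y₀ - u‖ ^ 2 - ‖y₁ - y₀‖ ^ 2 + 2 * (c * inner ℝ (y₁ - u) r) := by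
  have hmem : y₁ - u ∈ U := U.sub_mem (hy ▸ U.starProjection_apply_mem _) hu
  have h := U.starProjection_inner_eq_zero (y₀ + c • r) _ hmem
  rw [← hy] at h
  have hdec : y₀ + c • r - y₁ = c • r - (y₁ - y₀) := by abel
  rw [hdec, inner_sub_left, real_inner_smul_left, real_inner_comm] at h
  have hexp : y₀ - u = (y₁ - u) - (y₁ - y₀) := by abel
  rw [hexp, norm_sub_sq_real (y₁ - u), real_inner_comm]
  linarith

end DualStep

/-! ### One step of the method: the Fejér inequality -/

section Step

variable {l m n : ℕ} {f : Primal m n → ℝ} {X : Set (Primal m n)} {A : BlockMatrix l m n}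
  {b : Dual l n} {Ik : ℕ → Finset (Fin l)} {lam : ℕ → ℝ} {x : ℕ → Primal m n} {y p : ℕ → Dual l n}
  {τ : ℝ}

lemma convexOn_add_inner_constraintResidual (hf : ConvexOn ℝ X f) (q : Dual l n) :
    ConvexOn ℝ X fun z => f z + inner ℝ q (constraintResidual A b z) := by
  have hlin : ConvexOn ℝ X ((innerₛₗ ℝ q) ∘ₗ (Matrix.toLpLin 2 2 A : Primal m n →ₗ[ℝ] Dual l n)) :=
    LinearMap.convexOn _ hf.1
  refine ((hf.add hlin).add_const (-inner ℝ q b)).congr fun z _ => ?_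
  have : constraintResidual A b z = Matrix.toLpLin 2 2 A z - b := rfl
  simp only [Pi.add_apply, this, inner_sub_right, LinearMap.comp_apply, innerₛₗ_apply_apply]
  ring

lemma IsPDM.variational (h : IsPDM f X A b Ik lam x y p) (hf : ConvexOn ℝ X f) (k : ℕ)
    {z : Primal m n} (hz : z ∈ X) :
    f (x (k + 1)) + inner ℝ (p (k + 1)) (constraintResidual A b (x (k + 1))) ≤
      f z + inner ℝ (p (k + 1)) (constraintResidual A b z)
        + (lam (k + 1))⁻¹ * inner ℝ (x (k + 1) - x k) (z - x (k + 1)) :=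
  prox_variational (convexOn_add_inner_constraintResidual hf (p (k + 1)))
    (h.x_mem k) (h.x_step k) hz

lemma IsPDM.y_mem (h : IsPDM f X A b Ik lam x y p) : ∀ k, y k ∈ dualSet n (Ik k)
  | 0 => h.y_zero_mem
  | k + 1 => by
    rw [h.y_step k]
    exact Submodule.starProjection_apply_mem _ _

lemma IsPDM.y_sub_p (h : IsPDM f X A b Ik lam x y p) (k : ℕ) :
    y (k + 1) - p (k + 1) = lam (k + 1) •
      (dualSet n (Ik (k + 1))).starProjection (Matrix.toLpLin 2 2 A (x (k + 1) - x k)) := by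
  rw [h.y_step, h.p_step, ← map_sub, add_sub_add_left_eq_sub, ← smul_sub, constraintResidual_sub,
    map_smul]

/-- Both projections start from `y^{k-1}`, so the difference is `λ_k A_{I_k}(x^k - x^{k-1})` up to
padding. The `√2` of the step rule yields the factor 2 that absorbs the cross term in `IsPDM.fejer`.
-/
lemma IsPDM.norm_y_sub_p_sq_le (h : IsPDM f X A b Ik lam x y p) (hτ : τ ≤ 1)
    (hstep : StepRule A Ik lam τ) (k : ℕ) :
    2 * ‖y (k + 1) - p (k + 1)‖ ^ 2 ≤ (1 - τ) * ‖x (k + 1) - x k‖ ^ 2 := by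
  have hlam := h.lam_pos k
  have hup := (hstep (k + 1) (Nat.le_add_left 1 k)).2
  have h1 : ‖y (k + 1) - p (k + 1)‖ ≤
      lam (k + 1) * (‖subMatrix A (Ik (k + 1))‖ * ‖x (k + 1) - x k‖) := by
    rw [h.y_sub_p, norm_smul, Real.norm_of_nonneg hlam.le]
    exact mul_le_mul_of_nonneg_left (norm_starProjection_toLpLin_le _ _) hlam.le
  have h2 : √2 * ‖y (k + 1) - p (k + 1)‖ ≤ √(1 - τ) * ‖x (k + 1) - x k‖ := by
    calc √2 * ‖y (k + 1) - p (k + 1)‖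
        ≤ √2 * (lam (k + 1) * (‖subMatrix A (Ik (k + 1))‖ * ‖x (k + 1) - x k‖)) := by gcongr
      _ = lam (k + 1) * (√2 * ‖subMatrix A (Ik (k + 1))‖) * ‖x (k + 1) - x k‖ := by ring
      _ ≤ _ := by gcongr
  have h3 := pow_le_pow_left₀ (by positivity) h2 2
  rwa [mul_pow, mul_pow, Real.sq_sqrt zero_le_two, Real.sq_sqrt (sub_nonneg.2 hτ)] at h3

/-- The distance to a saddle point whose multiplier lies in `Y_{I_k}` decreases. -/
lemma IsPDM.fejer (h : IsPDM f X A b Ik lam x y p) (hf : ConvexOn ℝ X f) (hτ : τ ≤ 1)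
    (hstep : StepRule A Ik lam τ) (k : ℕ) {w : Primal m n × Dual l n}
    (hw : w ∈ saddleSet f X A b Finset.univ) (hwI : w.2 ∈ dualSet n (Ik (k + 1))) :
    ‖x (k + 1) - w.1‖ ^ 2 + ‖y (k + 1) - w.2‖ ^ 2
        + (τ * ‖x (k + 1) - x k‖ ^ 2 + (1 / 2) * ‖y (k + 1) - y k‖ ^ 2) ≤
      ‖x k - w.1‖ ^ 2 + ‖y k - w.2‖ ^ 2 := by
  obtain ⟨hx, h0, hz⟩ := mem_saddleSet_univ_iff.1 hw
  have hlam := h.lam_pos k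
  set r := constraintResidual A b (x (k + 1)) with hr
  have hvar := h.variational hf k hx
  have hsad := hz _ (h.x_mem k)
  rw [h0, inner_zero_right, add_zero, ← hr] at hvar
  rw [← hr] at hsad
  have hprimal : lam (k + 1) * (inner ℝ (p (k + 1)) r - inner ℝ w.2 r) ≤
      inner ℝ (x (k + 1) - x k) (w.1 - x (k + 1)) := by
    have h1 : inner ℝ (p (k + 1)) r - inner ℝ w.2 r ≤
        (lam (k + 1))⁻¹ * inner ℝ (x (k + 1) - x k) (w.1 - x (k + 1)) := by linarith
    have h2 := mul_le_mul_of_nonneg_left h1 hlam.le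
    rwa [mul_inv_cancel_left₀ hlam.ne'] at h2
  have hthree : ‖x k - w.1‖ ^ 2 = ‖x (k + 1) - w.1‖ ^ 2
      + 2 * inner ℝ (x (k + 1) - x k) (w.1 - x (k + 1)) + ‖x (k + 1) - x k‖ ^ 2 := by
    have hexp : x k - w.1 = (x (k + 1) - w.1) - (x (k + 1) - x k) := by abel
    rw [hexp, norm_sub_sq_real, real_inner_comm, ← neg_sub (x (k + 1)) w.1, inner_neg_right]
    ring
  have hdual := norm_sub_sq_of_starProjection (h.y_step k) hwI
  have hpmem : p (k + 1) ∈ dualSet n (Ik (k + 1)) := by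
    rw [h.p_step k]
    exact Submodule.starProjection_apply_mem _ _
  have hcross : lam (k + 1) * inner ℝ (y (k + 1) - p (k + 1)) r =
      inner ℝ (y (k + 1) - p (k + 1)) (y (k + 1) - y k) := by
    have h1 := Submodule.starProjection_inner_eq_zero (y k + lam (k + 1) • r) _
      (Submodule.sub_mem _ (h.y_mem (k + 1)) hpmem)
    rw [← h.y_step k] at h1
    have hdec : y k + lam (k + 1) • r - y (k + 1) = lam (k + 1) • r - (y (k + 1) - y k) := by abel
    rw [hdec, inner_sub_left, real_inner_smul_left, real_inner_comm,
      real_inner_comm _ (y (k + 1) - y k)] at h1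
    linarith
  have hcs := real_inner_le_norm (y (k + 1) - p (k + 1)) (y (k + 1) - y k)
  have hyp := h.norm_y_sub_p_sq_le hτ hstep k
  rw [← hr, inner_sub_left] at hdual
  rw [inner_sub_left] at hcross
  -- Adding the primal and dual estimates leaves the cross term `2⟨y - p, Δy⟩`. It is at most `2‖y -
  -- p‖² + ½‖Δy‖²`, hence at most `(1 - τ)‖Δx‖² + ½‖Δy‖²`.
  nlinarith [sq_nonneg (2 * ‖y (k + 1) - p (k + 1)‖ - ‖y (k + 1) - y k‖)]

end Step

/-! ### Limit points and convergence -/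

section Convergence

open Filter

variable {l m n : ℕ} {f : Primal m n → ℝ} {X : Set (Primal m n)} {A : BlockMatrix l m n}
  {b : Dual l n} {Ik : ℕ → Finset (Fin l)} {lam : ℕ → ℝ} {x : ℕ → Primal m n} {y p : ℕ → Dual l n}
  {τ : ℝ} {I : Finset (Fin l)} {w : Primal m n × Dual l n}

lemma IsPDM.antitone (h : IsPDM f X A b Ik lam x y p) (hf : ConvexOn ℝ X f)
    (hτ : τ ∈ Set.Ioo (0 : ℝ) 1) (hstep : StepRule A Ik lam τ) (hsub : ∀ k, 1 ≤ k → I ⊆ Ik k)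
    (hw : w ∈ saddleSet f X A b Finset.univ) (hwI : w.2 ∈ dualSet n I) :
    Antitone fun k => ‖x k - w.1‖ ^ 2 + ‖y k - w.2‖ ^ 2 := by
  refine antitone_nat_of_succ_le fun k => ?_
  have h1 := h.fejer hf hτ.2.le hstep k hw (dualSet_mono (hsub (k + 1) (Nat.le_add_left 1 k)) hwI)
  have h2 : 0 ≤ τ * ‖x (k + 1) - x k‖ ^ 2 := mul_nonneg hτ.1.le (sq_nonneg _)
  have h3 := sq_nonneg ‖y (k + 1) - y k‖
  linarith

/-- Consecutive iterates become arbitrarily close. -/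
lemma IsPDM.tendsto_norm_sub (h : IsPDM f X A b Ik lam x y p) (hf : ConvexOn ℝ X f)
    (hτ : τ ∈ Set.Ioo (0 : ℝ) 1) (hstep : StepRule A Ik lam τ) (hsub : ∀ k, 1 ≤ k → I ⊆ Ik k)
    (hw : w ∈ saddleSet f X A b Finset.univ) (hwI : w.2 ∈ dualSet n I) :
    Tendsto (fun k => ‖x (k + 1) - x k‖) atTop (𝓝 0) ∧
      Tendsto (fun k => ‖y (k + 1) - y k‖) atTop (𝓝 0) := by
  set a : ℕ → ℝ := fun k => ‖x k - w.1‖ ^ 2 + ‖y k - w.2‖ ^ 2 with ha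
  have hlim := tendsto_atTop_ciInf (h.antitone hf hτ hstep hsub hw hwI)
    ⟨0, by rintro _ ⟨k, rfl⟩; positivity⟩
  have hdiff : Tendsto (fun k => a k - a (k + 1)) atTop (𝓝 0) := by
    simpa using hlim.sub (hlim.comp (tendsto_add_atTop_nat 1))
  have hfejer := fun k =>
    h.fejer hf hτ.2.le hstep k hw (dualSet_mono (hsub (k + 1) (Nat.le_add_left 1 k)) hwI)
  have hτ0 := hτ.1
  have hsqrt : ∀ (u : ℕ → ℝ) (c : ℝ), (∀ k, 0 ≤ u k) → (∀ k, u k ^ 2 ≤ c * (a k - a (k + 1))) →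
      Tendsto u atTop (𝓝 0) := by
    intro u c hu hle
    have h1 : Tendsto (fun k => u k ^ 2) atTop (𝓝 0) :=
      squeeze_zero (fun k => sq_nonneg _) hle (by simpa using hdiff.const_mul c)
    simpa [Real.sqrt_sq (hu _)] using h1.sqrt
  constructor
  · refine hsqrt _ τ⁻¹ (fun _ => norm_nonneg _) fun k => ?_
    rw [le_inv_mul_iff₀ hτ0]
    have h1 := hfejer k
    have h2 := sq_nonneg ‖y (k + 1) - y k‖
    simp only [ha]
    linarith
  · refine hsqrt _ 2 (fun _ => norm_nonneg _) fun k => ?_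
    have h1 := hfejer k
    have h2 : 0 ≤ τ * ‖x (k + 1) - x k‖ ^ 2 := by positivity
    simp only [ha]
    linarith

/-- Fejér monotonicity confines the iterates to a ball. The free `φ` allows a limit to be taken
along the indices with `I_k = I`. -/
lemma IsPDM.exists_limitPoint (h : IsPDM f X A b Ik lam x y p) (hf : ConvexOn ℝ X f)
    (hτ : τ ∈ Set.Ioo (0 : ℝ) 1) (hstep : StepRule A Ik lam τ) (hsub : ∀ k, 1 ≤ k → I ⊆ Ik k)
    (hw : w ∈ saddleSet f X A b Finset.univ) (hwI : w.2 ∈ dualSet n I) (φ : ℕ → ℕ) :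
    ∃ v, ∃ ψ : ℕ → ℕ, StrictMono ψ ∧
      Tendsto (fun s => (x (φ (ψ s)), y (φ (ψ s)))) atTop (𝓝 v) := by
  set R := √(‖x 0 - w.1‖ ^ 2 + ‖y 0 - w.2‖ ^ 2)
  have hbound : ∀ k, (x k, y k) ∈ Metric.closedBall w R := by
    intro k
    have hk : ‖x k - w.1‖ ^ 2 + ‖y k - w.2‖ ^ 2 ≤ ‖x 0 - w.1‖ ^ 2 + ‖y 0 - w.2‖ ^ 2 :=
      h.antitone hf hτ hstep hsub hw hwI (Nat.zero_le k)
    rw [Metric.mem_closedBall, Prod.dist_eq, max_le_iff, dist_eq_norm, dist_eq_norm]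
    constructor
    · exact Real.le_sqrt_of_sq_le (by nlinarith [sq_nonneg ‖y k - w.2‖])
    · exact Real.le_sqrt_of_sq_le (by nlinarith [sq_nonneg ‖x k - w.1‖])
  obtain ⟨v, -, ψ, hψ, hlim⟩ := tendsto_subseq_of_bounded
    (Metric.isBounded_closedBall (x := w) (r := R)) (x := fun s => (x (φ s), y (φ s)))
    (fun s => hbound (φ s))
  exact ⟨v, ψ, hψ, hlim⟩

/-- The constraints of every index set contained in all `I_k` are satisfied in the limit. -/
lemma IsPDM.tendsto_starProjection_constraintResidual (h : IsPDM f X A b Ik lam x y p)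
    (hτ : 0 < τ) (hstep : StepRule A Ik lam τ) (hsub : ∀ k, 1 ≤ k → I ⊆ Ik k)
    (hy : Tendsto (fun k => ‖y (k + 1) - y k‖) atTop (𝓝 0)) :
    Tendsto (fun k => (dualSet n I).starProjection (constraintResidual A b (x (k + 1))))
      atTop (𝓝 0) := by
  rw [tendsto_zero_iff_norm_tendsto_zero]
  refine squeeze_zero (fun _ => norm_nonneg _) (fun k => ?_) (by simpa using hy.const_mul τ⁻¹)
  set U := dualSet n I
  set W := dualSet n (Ik (k + 1))
  set r := constraintResidual A b (x (k + 1)) with hr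
  have hlam := h.lam_pos k
  have hUW : U ≤ W := dualSet_mono (hsub (k + 1) (Nat.le_add_left 1 k))
  have hcomp : U.starProjection (W.starProjection r) = U.starProjection r :=
    congrArg (fun S => S r) (Submodule.starProjection_comp_starProjection_of_le hUW)
  -- The old `y k` may lie outside `W`, so the increment must be projected; this does not enlarge
  -- its norm.
  have hWr : lam (k + 1) • W.starProjection r = W.starProjection (y (k + 1) - y k) := by
    rw [map_sub, Submodule.starProjection_eq_self_iff.2 (h.y_mem (k + 1)), h.y_step k, map_add,
      map_smul, add_sub_cancel_left]
  have h1 : lam (k + 1) * ‖W.starProjection r‖ ≤ ‖y (k + 1) - y k‖ := by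
    have h2 := W.norm_starProjection_apply_le (y (k + 1) - y k)
    rwa [← hWr, norm_smul, Real.norm_of_nonneg hlam.le] at h2
  have h3 : ‖U.starProjection r‖ ≤ ‖W.starProjection r‖ := by
    rw [← hcomp]
    exact U.norm_starProjection_apply_le _
  rw [le_inv_mul_iff₀ hτ]
  calc τ * ‖U.starProjection r‖ ≤ lam (k + 1) * ‖W.starProjection r‖ :=
        mul_le_mul (hstep (k + 1) (Nat.le_add_left 1 k)).1 h3 (norm_nonneg _) hlam.le
    _ ≤ _ := h1

/-- Every limit point of the iterates is a saddle point. -/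
lemma IsPDM.limitPoint_mem_saddleSet (h : IsPDM f X A b Ik lam x y p) (hXclosed : IsClosed X)
    (hfX : ConvexOn ℝ X f) (hfc : Continuous f)
    (hτ : τ ∈ Set.Ioo (0 : ℝ) 1) (hstep : StepRule A Ik lam τ) (hI : IsBasic A b I)
    (hsub : ∀ k, 1 ≤ k → I ⊆ Ik k)
    (hw : w ∈ saddleSet f X A b Finset.univ) (hwI : w.2 ∈ dualSet n I)
    {v : Primal m n × Dual l n} (hv : IsLimitPoint (fun k => (x k, y k)) v) :
    v ∈ saddleSet f X A b Finset.univ := by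
  obtain ⟨φ, hφ, hlim⟩ := hv
  obtain ⟨hdx, hdy⟩ := h.tendsto_norm_sub hfX hτ hstep hsub hw hwI
  -- The step relations hold at successors only. Dropping the first term of `φ` makes every index
  -- positive.
  obtain ⟨ψ, hψ, hlimx, hlimy⟩ : ∃ ψ : ℕ → ℕ, Tendsto ψ atTop atTop ∧
      Tendsto (fun s => x (ψ s + 1)) atTop (𝓝 v.1) ∧
      Tendsto (fun s => y (ψ s + 1)) atTop (𝓝 v.2) := by
    refine ⟨fun s => φ (s + 1) - 1, ?_, ?_⟩
    · exact (tendsto_sub_atTop_nat 1).comp (hφ.tendsto_atTop.comp (tendsto_add_atTop_nat 1))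
    · have heq : ∀ s, φ (s + 1) - 1 + 1 = φ (s + 1) := fun s =>
        Nat.sub_add_cancel (le_trans (Nat.le_add_left 1 s) hφ.le_apply)
      simp only [heq]
      have hshift := hlim.comp (tendsto_add_atTop_nat 1)
      exact ⟨(continuous_fst.tendsto v).comp hshift, (continuous_snd.tendsto v).comp hshift⟩
  have hvX : v.1 ∈ X := hXclosed.mem_of_tendsto hlimx (Eventually.of_forall fun s => h.x_mem _)
  have hres : Tendsto (fun s => constraintResidual A b (x (ψ s + 1))) atTop
      (𝓝 (constraintResidual A b v.1)) :=
    (continuous_constraintResidual.tendsto v.1).comp hlimx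
  have hfeas : constraintResidual A b v.1 = 0 := by
    have h1 := (h.tendsto_starProjection_constraintResidual hτ.1 hstep hsub hdy).comp hψ
    have h2 := ((dualSet n I).starProjection.continuous.tendsto _).comp hres
    have h3 := tendsto_nhds_unique h2 h1
    exact mem_affineSet_univ_iff.1
      (hI.2 _ (starProjection_constraintResidual_eq_zero_iff.1 h3))
  refine mem_saddleSet_univ_iff.2 ⟨hvX, hfeas, fun z hz => ?_⟩
  have hyp : Tendsto (fun k => y (k + 1) - p (k + 1)) atTop (𝓝 0) := by
    rw [tendsto_zero_iff_norm_tendsto_zero]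
    refine squeeze_zero (fun _ => norm_nonneg _) (fun k => ?_) hdx
    have h1 := h.norm_y_sub_p_sq_le hτ.2.le hstep k
    refine le_of_sq_le_sq ?_ (norm_nonneg _)
    nlinarith [sq_nonneg ‖x (k + 1) - x k‖, sq_nonneg ‖y (k + 1) - p (k + 1)‖,
      mul_nonneg hτ.1.le (sq_nonneg ‖x (k + 1) - x k‖)]
  have hlimp : Tendsto (fun s => p (ψ s + 1)) atTop (𝓝 v.2) := by
    simpa using hlimy.sub (hyp.comp hψ)
  have hleft : Tendsto (fun s => f (x (ψ s + 1)) +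
      inner ℝ (p (ψ s + 1)) (constraintResidual A b (x (ψ s + 1)))) atTop (𝓝 (f v.1)) := by
    have := ((hfc.tendsto v.1).comp hlimx).add (hlimp.inner hres)
    rwa [hfeas, inner_zero_right, add_zero] at this
  -- The proximal term is replaced by a bound with `τ⁻¹`, since `λ_k` need not converge but is at
  -- least `τ`.
  have hright : Tendsto (fun s => f z + inner ℝ (p (ψ s + 1)) (constraintResidual A b z) +
      τ⁻¹ * (‖x (ψ s + 1) - x (ψ s)‖ * ‖z - x (ψ s + 1)‖)) atTop
      (𝓝 (f z + inner ℝ v.2 (constraintResidual A b z))) := by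
    have h1 := (hdx.comp hψ).mul (tendsto_const_nhds.sub hlimx : Tendsto
      (fun s => z - x (ψ s + 1)) atTop (𝓝 (z - v.1))).norm
    have h2 := ((hlimp.inner (tendsto_const_nhds (x := constraintResidual A b z))).const_add
      (f z)).add (h1.const_mul τ⁻¹)
    simpa using h2
  refine le_of_tendsto_of_tendsto' hleft hright fun s => ?_
  refine (h.variational hfX (ψ s) hz).trans ?_
  refine add_le_add_right ((mul_le_mul_of_nonneg_left (real_inner_le_norm _ _)
    (inv_nonneg.2 (h.lam_pos _).le)).trans ?_) _
  exact mul_le_mul_of_nonneg_right (inv_anti₀ hτ.1 (hstep _ (Nat.le_add_left 1 _)).1)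
    (by positivity)

/-- The iterates converge to a saddle point with multiplier in `Y_I` if it is a limit point. -/
lemma IsPDM.tendsto_of_limitPoint (h : IsPDM f X A b Ik lam x y p) (hf : ConvexOn ℝ X f)
    (hτ : τ ∈ Set.Ioo (0 : ℝ) 1) (hstep : StepRule A Ik lam τ) (hsub : ∀ k, 1 ≤ k → I ⊆ Ik k)
    (hw : w ∈ saddleSet f X A b Finset.univ) (hwI : w.2 ∈ dualSet n I)
    (hlim : IsLimitPoint (fun k => (x k, y k)) w) :
    Tendsto (fun k => (x k, y k)) atTop (𝓝 w) := by
  obtain ⟨φ, hφ, hlim⟩ := hlim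
  have hconv := tendsto_atTop_ciInf (h.antitone hf hτ hstep hsub hw hwI)
    ⟨0, by rintro _ ⟨k, rfl⟩; positivity⟩
  have hcont : Continuous fun v : Primal m n × Dual l n =>
      ‖v.1 - w.1‖ ^ 2 + ‖v.2 - w.2‖ ^ 2 := by fun_prop
  have hsubseq := (hcont.tendsto w).comp hlim
  simp only [sub_self, norm_zero, ne_eq, OfNat.ofNat_ne_zero, not_false_eq_true, zero_pow,
    add_zero] at hsubseq
  have hzero := tendsto_nhds_unique (hconv.comp hφ.tendsto_atTop) hsubseq
  rw [hzero] at hconv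
  have hsqrt := hconv.sqrt
  rw [Real.sqrt_zero] at hsqrt
  refine Tendsto.prodMk_nhds ?_ ?_ <;> rw [tendsto_iff_norm_sub_tendsto_zero] <;>
    refine squeeze_zero (fun _ => norm_nonneg _) (fun k => Real.le_sqrt_of_sq_le ?_) hsqrt
  · exact le_add_of_nonneg_right (sq_nonneg _)
  · exact le_add_of_nonneg_left (sq_nonneg _)

end Convergence

end PDM

/-! ### The theorem -/

theorem theorem3p2 {l m n : ℕ}
    (f : PDM.Primal m n → ℝ) (X : Set (PDM.Primal m n))
    (A : PDM.BlockMatrix l m n) (b : PDM.Dual l n)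
    (hsol : (PDM.solutionSet f X A b Finset.univ).Nonempty)
    (hXconv : Convex ℝ X) (hXclosed : IsClosed X)
    (hf : ConvexOn ℝ Set.univ f)
    (hqual : (intrinsicInterior ℝ X ∩ PDM.affineSet A b Finset.univ).Nonempty ∨
      (PDM.saddleSet f X A b Finset.univ).Nonempty)
    (Ik : ℕ → Finset (Fin l)) (lam : ℕ → ℝ)
    (x : ℕ → PDM.Primal m n) (y p : ℕ → PDM.Dual l n)
    (hpdm : PDM.IsPDM f X A b Ik lam x y p)
    (τ : ℝ) (hτ : τ ∈ Set.Ioo (0 : ℝ) 1) (hstep : PDM.StepRule A Ik lam τ)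
    (I : Finset (Fin l)) (hIne : I.Nonempty) (hI : PDM.IsBasic A b I)
    (hsub : ∀ k, 1 ≤ k → I ⊆ Ik k) :
    ((∃ w, PDM.IsLimitPoint (fun k => (x k, y k)) w) ∧
      (∀ w, PDM.IsLimitPoint (fun k => (x k, y k)) w →
        w ∈ PDM.saddleSet f X A b Finset.univ)) ∧
    ((∃ φ : ℕ → ℕ, StrictMono φ ∧ ∀ s, Ik (φ s) = I) →
      ∃ w ∈ PDM.saddleSet f X A b Finset.univ,
        Filter.Tendsto (fun k => (x k, y k)) Filter.atTop (𝓝 w)) := by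
  have hfX : ConvexOn ℝ X f := hf.subset (Set.subset_univ _) hXconv
  have hfc : Continuous f := hf.locallyLipschitz.continuous
  have hne : (PDM.saddleSet f X A b Finset.univ).Nonempty :=
    hqual.elim (PDM.saddleSet_nonempty_of_intrinsicInterior hXconv hf hsol) id
  obtain ⟨w₀, hw₀, hw₀I⟩ := PDM.exists_saddle_mem_dualSet hI hne
  have hmem : ∀ w, PDM.IsLimitPoint (fun k => (x k, y k)) w →
      w ∈ PDM.saddleSet f X A b Finset.univ := fun w hw =>
    hpdm.limitPoint_mem_saddleSet hXclosed hfX hfc hτ hstep hI hsub hw₀ hw₀I hw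
  refine ⟨⟨?_, hmem⟩, ?_⟩
  · obtain ⟨v, ψ, hψ, hlim⟩ := hpdm.exists_limitPoint hfX hτ hstep hsub hw₀ hw₀I id
    exact ⟨v, ψ, hψ, hlim⟩
  · rintro ⟨φ, hφ, hIφ⟩
    obtain ⟨v, ψ, hψ, hlim⟩ := hpdm.exists_limitPoint hfX hτ hstep hsub hw₀ hw₀I φ
    have hv : PDM.IsLimitPoint (fun k => (x k, y k)) v := ⟨φ ∘ ψ, hφ.comp hψ, hlim⟩
    have hvI : v.2 ∈ PDM.dualSet n I := by
      refine (Submodule.closed_of_finiteDimensional (PDM.dualSet n I)).mem_of_tendsto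
        ((continuous_snd.tendsto v).comp hlim) (Filter.Eventually.of_forall fun s => ?_)
      have := hpdm.y_mem (φ (ψ s))
      rwa [hIφ] at this
    exact ⟨v, hmem v hv, hpdm.tendsto_of_limitPoint hfX hτ hstep hsub (hmem v hv) hvI hv⟩
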